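/- Let $\mathcal H$ be a separable complex Hilbert space with identity $I$, and let $\|\cdot\|$ be the operator norm on $\mathcal B(\mathcal H)$. Let $\mathcal C_2$ and $\mathcal C_1$ be the ideals of Hilbert--Schmidt and trace class operators, with norms $\|\cdot\|_2$ and $\|\cdot\|_1$. Let $N\in\mathbb N$ and let $\lambda_1,\dots,\lambda_N,w_1,\dots,w_N\in[0,\infty)$. For $T=(T_n)_{n=1}^N$ in $\mathcal B(\mathcal H)$ and $t>0$ put $$T_t=\Big(tI+\sum_{n=1}^N T_n^*T_n\Big)^{1/2},\qquad T^{(v)}_{*,t}=\Big(tI+\sum_{n=1}^N v_nT_nT_n^*\Big)^{1/2}\quad (v=\lambda \text{ or } v=w).$$ All sums and maxima below are over $1\le n\le N$. (i) For all $N$-tuples $A,B,C,D$ in $\mathcal B(\mathcal H)$ and all $\eta,\zeta,\theta>0$, $$\Big\|(A^{(\lambda)}_{*,\eta})^{-1}\sum_n\lambda_n^{1/2}A_nC_nXD_nB_n\,B_\zeta^{-1}\Big\|\le\max_n\|C_n\|\|D_n\|\;\|X\|\quad(X\in\mathcal B(\mathcal H)),\tag{1}$$ $$\Big\|\sum_n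 A_nC_nC_\eta^{-1}XD_nB_nB_\zeta^{-1}\Big\|_2\le\max_n\|A_n\|\max_n\|D_n\|\;\|X\|_2\quad(X\in\mathcal C_2),\tag{2}$$ $$\Big\|(A^{(\lambda)}_{*,\eta})^{-1}\sum_n\lambda_n^{1/2}w_n^{1/2}A_nC_nX(D^{(w)}_{*,\theta})^{-1}D_nB_n\Big\|_2\le\max_n\|B_n\|\max_n\|C_n\|\;\|X\|_2\quad(X\in\mathcal C_2),\tag{3}$$ $$\Big\|\sum_n w_n^{1/2}A_nC_nC_\eta^{-1}X(D^{(w)}_{*,\theta})^{-1}D_nB_n\Big\|_1\le\max_n\|A_n\|\|B_n\|\;\|X\|_1\quad(X\in\mathcal C_1).\tag{4}$$ (ii) For all $N$-tuples $A,B,C,D$ in $\mathcal B(\mathcal H)$, $$\Big\|\sum_n\lambda_n^{1/2}A_nC_nXD_nB_n\Big\|\le\max_n\|C_n\|\|D_n\|\Big\|\sum_n\lambda_nA_nA_n^*\Big\|^{1/2}\Big\|\sum_nB_n^*B_n\Big\|^{1/2}\|X\|\quad(X\in\mathcal B(\mathcal H)),\tag{1'}$$ $$\Big\|\sum_nA_nC_nXD_nB_n\Big\|_2\le\max_n\|A_n\|\max_n\|D_n\|\Big\|\sum_nB_n^*B_n\Big\|^{1/2}\Big\|\Big(\sum_nC_n^*C_n\Big)^{1/2}X\Big\|_2\quad(X\in\mathcal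 C_2),\tag{2'}$$ $$\Big\|\sum_n\lambda_n^{1/2}w_n^{1/2}A_nC_nXD_nB_n\Big\|_2\le\max_n\|B_n\|\max_n\|C_n\|\Big\|\sum_n\lambda_nA_nA_n^*\Big\|^{1/2}\Big\|X\Big(\sum_nw_nD_nD_n^*\Big)^{1/2}\Big\|_2\quad(X\in\mathcal C_2),\tag{3'}$$ $$\Big\|\sum_nw_n^{1/2}A_nC_nXD_nB_n\Big\|_1\le\max_n\|A_n\|\|B_n\|\Big\|\Big(\sum_nC_n^*C_n\Big)^{1/2}X\Big(\sum_nw_nD_nD_n^*\Big)^{1/2}\Big\|_1\quad(X\in\mathcal C_1).\tag{4'}$$ Moreover, for fixed $N,\lambda,w$, each of (1)--(4), asserted for all tuples $A,B,C,D$, all parameters and all $X$ in the indicated class, is equivalent to the corresponding one of (1')--(4'), asserted for all tuples and all such $X$. In particular the two quadruples are equivalent. (iii) Each of the two quadruples (1)--(4) and (1')--(4') implies the following contractive estimates, which therefore hold for all $N$-tuples $A,B$ in $\mathcal B(\mathcal H)$ and all $\varepsilon,\zeta,\eta,\theta>0$: $$\Big\|(A^{(\lambda)}_{*,\eta})^{-1}\sum_n\lambda_n^{1/2}A_nXB_n\,B_\zeta^{-1}\Big\|\le\|X\|\quad(X\in\mathcal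 B(\mathcal H)),$$ $$\Big\|\sum_nA_nA_\varepsilon^{-1}XB_nB_\zeta^{-1}\Big\|_2\le\|X\|_2\quad(X\in\mathcal C_2),$$ $$\Big\|(A^{(\lambda)}_{*,\eta})^{-1}\sum_n\lambda_n^{1/2}w_n^{1/2}A_nX(B^{(w)}_{*,\theta})^{-1}B_n\Big\|_2\le\|X\|_2\quad(X\in\mathcal C_2),$$ $$\Big\|\sum_nw_n^{1/2}A_nA_\varepsilon^{-1}X(B^{(w)}_{*,\theta})^{-1}B_n\Big\|_1\le\|X\|_1\quad(X\in\mathcal C_1).$$ -/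

import Mathlib

open scoped ENNReal InnerProductSpace

noncomputable section

namespace SchattenCS

universe u

section Norms

variable {H : Type u} [NormedAddCommGroup H] [InnerProductSpace ℂ H] [CompleteSpace H]

theorem enorm_sq_eq_tsum {ι : Type*} (b : HilbertBasis ι ℂ H) (x : H) :
    ‖x‖ₑ ^ 2 = ∑' i, ‖⟪b i, x⟫_ℂ‖ₑ ^ 2 := by
  have h2 : HasSum (fun j => ‖⟪b j, x⟫_ℂ‖ ^ 2) (‖x‖ ^ 2) := by
    have := Complex.hasSum_re (b.hasSum_inner_mul_inner x x)
    convert this using 1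
    · funext j
      rw [← inner_conj_symm x (b j), ← Complex.normSq_eq_conj_mul_self, Complex.ofReal_re,
        Complex.normSq_eq_norm_sq]
    · rw [inner_self_eq_norm_sq_to_K]
      norm_cast
  have h3 : ∀ i, ‖⟪b i, x⟫_ℂ‖ₑ ^ 2 = ENNReal.ofReal (‖⟪b i, x⟫_ℂ‖ ^ 2) := fun i => by
    rw [ENNReal.ofReal_pow (norm_nonneg _), ofReal_norm]
  rw [tsum_congr h3, ← ENNReal.ofReal_tsum_of_nonneg (fun _ => by positivity) h2.summable,
    h2.tsum_eq, ENNReal.ofReal_pow (norm_nonneg _), ofReal_norm]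

theorem tsum_enorm_sq_eq_adjoint {ι κ : Type*} (b : HilbertBasis ι ℂ H) (c : HilbertBasis κ ℂ H)
    (X : H →L[ℂ] H) :
    ∑' i, ‖X (b i)‖ₑ ^ 2 = ∑' j, ‖(ContinuousLinearMap.adjoint X) (c j)‖ₑ ^ 2 :=
  calc ∑' i, ‖X (b i)‖ₑ ^ 2 = ∑' i, ∑' j, ‖⟪c j, X (b i)⟫_ℂ‖ₑ ^ 2 :=
        tsum_congr fun _ => enorm_sq_eq_tsum c _
    _ = ∑' j, ∑' i, ‖⟪c j, X (b i)⟫_ℂ‖ₑ ^ 2 := ENNReal.tsum_comm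
    _ = ∑' j, ∑' i, ‖⟪b i, (ContinuousLinearMap.adjoint X) (c j)⟫_ℂ‖ₑ ^ 2 := by
        refine tsum_congr fun j => tsum_congr fun i => ?_
        rw [ContinuousLinearMap.adjoint_inner_right, ← inner_conj_symm, RCLike.enorm_conj]
    _ = _ := tsum_congr fun _ => (enorm_sq_eq_tsum b _).symm

/-- The sum `∑ ‖X eᵢ‖² = tr (X* X)` over a Hilbert basis does not depend on the basis. -/
theorem tsum_enorm_sq_eq {ι κ : Type*} (b : HilbertBasis ι ℂ H) (c : HilbertBasis κ ℂ H)
    (X : H →L[ℂ] H) :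
    ∑' i, ‖X (b i)‖ₑ ^ 2 = ∑' j, ‖X (c j)‖ₑ ^ 2 := by
  rw [tsum_enorm_sq_eq_adjoint b c, ← tsum_enorm_sq_eq_adjoint c c]

variable (H) in
/-- A Hilbert basis of `H`, chosen once and for all. -/
def basisSet : Set H := (exists_hilbertBasis ℂ H).choose

variable (H) in
/-- A Hilbert basis of `H`, chosen once and for all. -/
def basis : HilbertBasis (basisSet H) ℂ H := (exists_hilbertBasis ℂ H).choose_spec.choose

/-- The Hilbert-Schmidt norm `‖X‖₂ = (∑ ‖X eᵢ‖²) ^ (1/2) ∈ [0, ∞]` of a bounded operator. -/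
def hsNorm (X : H →L[ℂ] H) : ℝ≥0∞ := (∑' i, ‖X (basis H i)‖ₑ ^ 2) ^ (1 / 2 : ℝ)

/-- The trace norm `‖X‖₁ = tr |X| = ∑ ⟨|X| eᵢ, eᵢ⟩ ∈ [0, ∞]` of a bounded operator,
where `|X| = (X* X) ^ (1/2)`. -/
def traceNorm (X : H →L[ℂ] H) : ℝ≥0∞ :=
  ∑' i, ENNReal.ofReal (RCLike.re ⟪CFC.abs X (basis H i), basis H i⟫_ℂ)

/-- Membership in the ideal of Hilbert-Schmidt operators. -/
def IsHilbertSchmidt (X : H →L[ℂ] H) : Prop := hsNorm X < ∞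

/-- Membership in the ideal of nuclear (trace class) operators. -/
def IsTraceClass (X : H →L[ℂ] H) : Prop := traceNorm X < ∞

/-- The Hilbert-Schmidt norm may be computed in any Hilbert basis. -/
theorem hsNorm_eq {ι : Type*} (b : HilbertBasis ι ℂ H) (X : H →L[ℂ] H) :
    hsNorm X = (∑' i, ‖X (b i)‖ₑ ^ 2) ^ (1 / 2 : ℝ) := by
  rw [hsNorm, tsum_enorm_sq_eq (basis H) b]

/-- The trace norm may be computed in any Hilbert basis. -/
theorem traceNorm_eq {ι : Type*} (b : HilbertBasis ι ℂ H) (X : H →L[ℂ] H) :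
    traceNorm X = ∑' i, ENNReal.ofReal (RCLike.re ⟪CFC.abs X (b i), b i⟫_ℂ) := by
  have h : ∀ x : H, ENNReal.ofReal (RCLike.re ⟪CFC.abs X x, x⟫_ℂ)
      = ‖CFC.sqrt (CFC.abs X) x‖ₑ ^ 2 := by
    intro x
    have hs : CFC.sqrt (CFC.abs X) * CFC.sqrt (CFC.abs X) = CFC.abs X :=
      CFC.sqrt_mul_sqrt_self _ (CFC.abs_nonneg X)
    have hsa : IsSelfAdjoint (CFC.sqrt (CFC.abs X)) := (CFC.sqrt_nonneg _).isSelfAdjoint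
    have : ⟪CFC.abs X x, x⟫_ℂ = ⟪CFC.sqrt (CFC.abs X) x, CFC.sqrt (CFC.abs X) x⟫_ℂ := by
      conv_lhs => rw [← hs, ← hsa.star_eq]
      rw [mul_apply_eq_comp, ContinuousLinearMap.star_eq_adjoint,
        ContinuousLinearMap.adjoint_inner_left, ← ContinuousLinearMap.star_eq_adjoint, hsa.star_eq]
    rw [this, inner_self_eq_norm_sq, ENNReal.ofReal_pow (norm_nonneg _), ofReal_norm]
  simp only [traceNorm, h]
  exact tsum_enorm_sq_eq _ _ _

end Norms

section Families

variable {H : Type u} [NormedAddCommGroup H] [InnerProductSpace ℂ H] [CompleteSpace H] {N : ℕ}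

/-- `∑ₙ Tₙ* Tₙ`. -/
def dirSum (T : Fin N → H →L[ℂ] H) : H →L[ℂ] H := ∑ n, star (T n) * T n

/-- `∑ₙ lₙ Tₙ Tₙ*`. -/
def starSum (l : Fin N → ℝ) (T : Fin N → H →L[ℂ] H) : H →L[ℂ] H :=
  ∑ n, l n • (T n * star (T n))

/-- `(t I + ∑ₙ Tₙ* Tₙ) ^ (1/2)`. -/
def dirRoot (t : ℝ) (T : Fin N → H →L[ℂ] H) : H →L[ℂ] H := CFC.sqrt (t • 1 + dirSum T)

/-- `(t I + ∑ₙ lₙ Tₙ Tₙ*) ^ (1/2)`. -/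
def starRoot (t : ℝ) (l : Fin N → ℝ) (T : Fin N → H →L[ℂ] H) : H →L[ℂ] H :=
  CFC.sqrt (t • 1 + starSum l T)

theorem dirSum_nonneg (T : Fin N → H →L[ℂ] H) : 0 ≤ dirSum T :=
  Finset.sum_nonneg fun _ _ => star_mul_self_nonneg _

theorem starSum_nonneg {l : Fin N → ℝ} (hl : ∀ n, 0 ≤ l n) (T : Fin N → H →L[ℂ] H) :
    0 ≤ starSum l T :=
  Finset.sum_nonneg fun n _ => smul_nonneg (hl n) (mul_star_self_nonneg _)

theorem isUnit_sqrt_add {t : ℝ} (ht : 0 < t) {S : H →L[ℂ] H} (hS : 0 ≤ S) :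
    IsUnit (CFC.sqrt (t • 1 + S)) := by
  have h1 : IsStrictlyPositive (t • (1 : H →L[ℂ] H)) :=
    IsStrictlyPositive.smul ht isStrictlyPositive_one
  exact (h1.add_nonneg hS).isUnit_cfcSqrt

/-- The regularised roots are invertible, so that `Ring.inverse` gives their inverses. -/
theorem isUnit_dirRoot {t : ℝ} (ht : 0 < t) (T : Fin N → H →L[ℂ] H) : IsUnit (dirRoot t T) :=
  isUnit_sqrt_add ht (dirSum_nonneg T)

theorem isUnit_starRoot {t : ℝ} (ht : 0 < t) {l : Fin N → ℝ} (hl : ∀ n, 0 ≤ l n)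
    (T : Fin N → H →L[ℂ] H) : IsUnit (starRoot t l T) :=
  isUnit_sqrt_add ht (starSum_nonneg hl T)

end Families

section Bounds

/-! In all bounds below `N` is the number of operators in each family, `l` and `w` are the
weights, and `⨆ n` is the maximum over the finite index set. -/

variable (H : Type u) [NormedAddCommGroup H] [InnerProductSpace ℂ H] [CompleteSpace H]
variable {N : ℕ}

/-- Normalised bound in the operator norm. -/
def NormalisedOp (l : Fin N → ℝ) : Prop :=
  ∀ (A B C D : Fin N → H →L[ℂ] H) (η ζ : ℝ), 0 < η → 0 < ζ → ∀ X : H →L[ℂ] H,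
    ‖Ring.inverse (starRoot η l A) * (∑ n, √(l n) • (A n * C n * X * D n * B n))
        * Ring.inverse (dirRoot ζ B)‖ₑ
      ≤ (⨆ n, ‖C n‖ₑ * ‖D n‖ₑ) * ‖X‖ₑ

/-- First normalised bound in the Hilbert-Schmidt norm. -/
def NormalisedHSRight (N : ℕ) : Prop :=
  ∀ (A B C D : Fin N → H →L[ℂ] H) (η ζ : ℝ), 0 < η → 0 < ζ →
    ∀ X : H →L[ℂ] H, IsHilbertSchmidt X →
    hsNorm (∑ n, A n * C n * Ring.inverse (dirRoot η C) * X * D n * B n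
        * Ring.inverse (dirRoot ζ B))
      ≤ (⨆ n, ‖A n‖ₑ) * (⨆ n, ‖D n‖ₑ) * hsNorm X

/-- Second normalised bound in the Hilbert-Schmidt norm. -/
def NormalisedHSLeft (l w : Fin N → ℝ) : Prop :=
  ∀ (A B C D : Fin N → H →L[ℂ] H) (η θ : ℝ), 0 < η → 0 < θ →
    ∀ X : H →L[ℂ] H, IsHilbertSchmidt X →
    hsNorm (Ring.inverse (starRoot η l A) *
        ∑ n, (√(l n) * √(w n)) • (A n * C n * X * Ring.inverse (starRoot θ w D) * D n * B n))
      ≤ (⨆ n, ‖B n‖ₑ) * (⨆ n, ‖C n‖ₑ) * hsNorm X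

/-- Normalised bound in the trace norm. -/
def NormalisedTrace (w : Fin N → ℝ) : Prop :=
  ∀ (A B C D : Fin N → H →L[ℂ] H) (η θ : ℝ), 0 < η → 0 < θ →
    ∀ X : H →L[ℂ] H, IsTraceClass X →
    traceNorm (∑ n, √(w n) • (A n * C n * Ring.inverse (dirRoot η C) * X
        * Ring.inverse (starRoot θ w D) * D n * B n))
      ≤ (⨆ n, ‖A n‖ₑ * ‖B n‖ₑ) * traceNorm X

/-- Unnormalised bound in the operator norm. -/
def UnnormalisedOp (l : Fin N → ℝ) : Prop :=
  ∀ (A B C D : Fin N → H →L[ℂ] H) (X : H →L[ℂ] H),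
    ‖∑ n, √(l n) • (A n * C n * X * D n * B n)‖ₑ
      ≤ (⨆ n, ‖C n‖ₑ * ‖D n‖ₑ) * ‖starSum l A‖ₑ ^ (1 / 2 : ℝ) * ‖dirSum B‖ₑ ^ (1 / 2 : ℝ)
        * ‖X‖ₑ

/-- First unnormalised bound in the Hilbert-Schmidt norm. -/
def UnnormalisedHSRight (N : ℕ) : Prop :=
  ∀ (A B C D : Fin N → H →L[ℂ] H) (X : H →L[ℂ] H), IsHilbertSchmidt X →
    hsNorm (∑ n, A n * C n * X * D n * B n)
      ≤ (⨆ n, ‖A n‖ₑ) * (⨆ n, ‖D n‖ₑ) * ‖dirSum B‖ₑ ^ (1 / 2 : ℝ)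
        * hsNorm (CFC.sqrt (dirSum C) * X)

/-- Second unnormalised bound in the Hilbert-Schmidt norm. -/
def UnnormalisedHSLeft (l w : Fin N → ℝ) : Prop :=
  ∀ (A B C D : Fin N → H →L[ℂ] H) (X : H →L[ℂ] H), IsHilbertSchmidt X →
    hsNorm (∑ n, (√(l n) * √(w n)) • (A n * C n * X * D n * B n))
      ≤ (⨆ n, ‖B n‖ₑ) * (⨆ n, ‖C n‖ₑ) * ‖starSum l A‖ₑ ^ (1 / 2 : ℝ)
        * hsNorm (X * CFC.sqrt (starSum w D))

/-- Unnormalised bound in the trace norm. -/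
def UnnormalisedTrace (w : Fin N → ℝ) : Prop :=
  ∀ (A B C D : Fin N → H →L[ℂ] H) (X : H →L[ℂ] H), IsTraceClass X →
    traceNorm (∑ n, √(w n) • (A n * C n * X * D n * B n))
      ≤ (⨆ n, ‖A n‖ₑ * ‖B n‖ₑ)
        * traceNorm (CFC.sqrt (dirSum C) * X * CFC.sqrt (starSum w D))

/-- Contractive estimate in the operator norm. -/
def ContractiveOp (l : Fin N → ℝ) : Prop :=
  ∀ (A B : Fin N → H →L[ℂ] H) (η ζ : ℝ), 0 < η → 0 < ζ → ∀ X : H →L[ℂ] H,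
    ‖Ring.inverse (starRoot η l A) * (∑ n, √(l n) • (A n * X * B n))
        * Ring.inverse (dirRoot ζ B)‖ₑ ≤ ‖X‖ₑ

/-- First contractive estimate in the Hilbert-Schmidt norm. -/
def ContractiveHSRight (N : ℕ) : Prop :=
  ∀ (A B : Fin N → H →L[ℂ] H) (ε ζ : ℝ), 0 < ε → 0 < ζ →
    ∀ X : H →L[ℂ] H, IsHilbertSchmidt X →
    hsNorm (∑ n, A n * Ring.inverse (dirRoot ε A) * X * B n * Ring.inverse (dirRoot ζ B))
      ≤ hsNorm X

/-- Second contractive estimate in the Hilbert-Schmidt norm. -/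
def ContractiveHSLeft (l w : Fin N → ℝ) : Prop :=
  ∀ (A B : Fin N → H →L[ℂ] H) (η θ : ℝ), 0 < η → 0 < θ →
    ∀ X : H →L[ℂ] H, IsHilbertSchmidt X →
    hsNorm (Ring.inverse (starRoot η l A) *
        ∑ n, (√(l n) * √(w n)) • (A n * X * Ring.inverse (starRoot θ w B) * B n))
      ≤ hsNorm X

/-- Contractive estimate in the trace norm. -/
def ContractiveTrace (w : Fin N → ℝ) : Prop :=
  ∀ (A B : Fin N → H →L[ℂ] H) (ε θ : ℝ), 0 < ε → 0 < θ →
    ∀ X : H →L[ℂ] H, IsTraceClass X →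
    traceNorm (∑ n, √(w n) • (A n * Ring.inverse (dirRoot ε A) * X
        * Ring.inverse (starRoot θ w B) * B n))
      ≤ traceNorm X

/-- The four normalised bounds. -/
def NormalisedBounds (l w : Fin N → ℝ) : Prop :=
  NormalisedOp H l ∧ NormalisedHSRight H N ∧ NormalisedHSLeft H l w ∧ NormalisedTrace H w

/-- The four unnormalised bounds. -/
def UnnormalisedBounds (l w : Fin N → ℝ) : Prop :=
  UnnormalisedOp H l ∧ UnnormalisedHSRight H N ∧ UnnormalisedHSLeft H l w ∧ UnnormalisedTrace H w

/-- The four contractive estimates. -/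
def ContractiveBounds (l w : Fin N → ℝ) : Prop :=
  ContractiveOp H l ∧ ContractiveHSRight H N ∧ ContractiveHSLeft H l w ∧ ContractiveTrace H w

end Bounds

end SchattenCS

end

noncomputable section

namespace SchattenCS

set_option linter.unusedSectionVars false

/-! ### Cauchy-Schwarz in `[0, ∞]`. -/

section CauchySchwarz

/-! Each sum is a row of operators times a diagonal times a column. A row has the norm of its
adjoint column (`ColumnBound.row`), and a column with entries `T n` is controlled by `∑ Tₙ* Tₙ`. In
the operator norm the three factors multiply. In the Hilbert-Schmidt norm, a column applied to `X`
gives a square-summable diagonal, which is then paired with the remaining row or column. In the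
trace norm, polar decomposition splits `X` into two Hilbert-Schmidt factors, one absorbed by the
column and one by the row, and Cauchy-Schwarz joins them.

Normalised bounds use that `Tₙ (tI + ∑ Tₖ* Tₖ)^(-1/2)` is a column contraction. The unnormalised
trace bound gets its contractions from Douglas' factorisation, since `(∑ Tₖ* Tₖ)^(1/2)` need not be
invertible. Both quadruples are proved outright, so the equivalences hold between true statements;
the contractive estimates are the normalised ones with two families equal to the identity. -/

theorem rpow_half_sq (a : ℝ≥0∞) : (a ^ (1 / 2 : ℝ)) ^ 2 = a := by
  rw [← ENNReal.rpow_natCast, ← ENNReal.rpow_mul]; norm_num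

theorem le_of_sq_le_sq {a b : ℝ≥0∞} (h : a ^ 2 ≤ b ^ 2) : a ≤ b :=
  (ENNReal.pow_right_strictMono two_ne_zero).le_iff_le.1 h

/-- Cauchy-Schwarz for finite sums in `[0, ∞]`. -/
theorem sum_mul_le_sqrt_mul_sqrt {ι : Type*} (s : Finset ι) (a b : ι → ℝ≥0∞) :
    ∑ i ∈ s, a i * b i ≤ (∑ i ∈ s, a i ^ 2) ^ (1 / 2 : ℝ) * (∑ i ∈ s, b i ^ 2) ^ (1 / 2 : ℝ) := by
  simpa using ENNReal.inner_le_Lp_mul_Lq s a b Real.HolderConjugate.two_two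

/-- Cauchy-Schwarz for infinite sums in `[0, ∞]`. -/
theorem tsum_mul_le_sqrt_mul_sqrt {ι : Type*} (a b : ι → ℝ≥0∞) :
    ∑' i, a i * b i ≤ (∑' i, a i ^ 2) ^ (1 / 2 : ℝ) * (∑' i, b i ^ 2) ^ (1 / 2 : ℝ) := by
  rw [ENNReal.tsum_eq_iSup_sum]
  refine iSup_le fun s => (sum_mul_le_sqrt_mul_sqrt s a b).trans ?_
  gcongr <;> exact ENNReal.sum_le_tsum s

theorem sum_mul_sq_le {ι : Type*} (s : Finset ι) (a b : ι → ℝ≥0∞) :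
    (∑ i ∈ s, a i * b i) ^ 2 ≤ (∑ i ∈ s, a i ^ 2) * ∑ i ∈ s, b i ^ 2 := by
  refine (pow_le_pow_left₀ zero_le (sum_mul_le_sqrt_mul_sqrt s a b) 2).trans_eq ?_
  rw [mul_pow, rpow_half_sq, rpow_half_sq]

end CauchySchwarz

/-! ### Douglas' factorisation. -/

section Factorisation

variable {E F G : Type*} [NormedAddCommGroup E] [InnerProductSpace ℂ E]
  [NormedAddCommGroup F] [InnerProductSpace ℂ F] [CompleteSpace F]
  [NormedAddCommGroup G] [InnerProductSpace ℂ G] [CompleteSpace G]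

/-- Douglas' factorisation: an operator dominated by `S` factors through `S` by a contraction. -/
theorem exists_contraction_comp_eq (T : E →L[ℂ] F) (S : E →L[ℂ] G) (h : ∀ x, ‖T x‖ ≤ ‖S x‖) :
    ∃ W : G →L[ℂ] F, (∀ y, ‖W y‖ ≤ ‖y‖) ∧ ∀ x, W (S x) = T x := by
  let K : Submodule ℂ G := (LinearMap.range S.toLinearMap).topologicalClosure
  have hK : ∀ x, S x ∈ K := fun x => Submodule.le_topologicalClosure _ ⟨x, rfl⟩
  let e : E →ₗ[ℂ] K := S.toLinearMap.codRestrict K hK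
  have : CompleteSpace K :=
    (Submodule.isClosed_topologicalClosure (LinearMap.range S.toLinearMap)).completeSpace_coe
  have hd : DenseRange e := by
    intro y
    rw [closure_subtype]
    have hy : (y : G) ∈ closure (Set.range S) := y.2
    convert! hy using 2
    ext z
    constructor
    · rintro ⟨_, ⟨x, rfl⟩, rfl⟩
      exact ⟨x, rfl⟩
    · rintro ⟨x, rfl⟩
      exact ⟨e x, ⟨x, rfl⟩, rfl⟩
  have hn : ∀ x, ‖T.toLinearMap x‖ ≤ 1 * ‖e x‖ := fun x => by simpa using! h x
  -- `S x ↦ T x` is well defined and contractive on the range of `S`; it extends to the closure `K`,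
  -- and then to `G` by zero on the orthogonal complement of `K`.
  refine ⟨(T.toLinearMap.extendOfNorm e).comp K.orthogonalProjectionOnto, fun y => ?_, fun x => ?_⟩
  · refine (LinearMap.norm_extendOfNorm_apply_le hd 1 hn _).trans ?_
    rw [one_mul]
    exact K.norm_orthogonalProjectionOnto_apply_le y
  · have hx : K.orthogonalProjectionOnto (S x) = e x :=
      K.orthogonalProjectionOnto_mem_subspace_eq_self (e x)
    rw [ContinuousLinearMap.comp_apply, hx]
    exact LinearMap.extendOfNorm_eq hd ⟨1, hn⟩ x

end Factorisation

/-! ### Rows and columns of operators. -/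

section Columns

variable {H : Type*} [NormedAddCommGroup H] [InnerProductSpace ℂ H] [CompleteSpace H] {N : ℕ}

/-- The column with entries `T n` is dominated by `R`, that is, `∑ₙ Tₙ* Tₙ ≤ R* R`. -/
def ColumnLE (T : Fin N → H →L[ℂ] H) (R : H →L[ℂ] H) : Prop :=
  ∀ x, ∑ n, ‖T n x‖ₑ ^ 2 ≤ ‖R x‖ₑ ^ 2

/-- The column with entries `T n` has norm at most `k`. -/
def ColumnBound (T : Fin N → H →L[ℂ] H) (k : ℝ≥0∞) : Prop :=
  ∀ x, ∑ n, ‖T n x‖ₑ ^ 2 ≤ k ^ 2 * ‖x‖ₑ ^ 2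

theorem inner_dirSum (T : Fin N → H →L[ℂ] H) (x : H) :
    RCLike.re ⟪dirSum T x, x⟫_ℂ = ∑ n, ‖T n x‖ ^ 2 := by
  simp only [dirSum, sum_apply, sum_inner, map_sum]
  refine Finset.sum_congr rfl fun n _ => ?_
  rw [ContinuousLinearMap.star_eq_adjoint]
  change RCLike.re ⟪ContinuousLinearMap.adjoint (T n) (T n x), x⟫_ℂ = _
  rw [ContinuousLinearMap.adjoint_inner_left, inner_self_eq_norm_sq]

theorem norm_sqrt_apply_sq {S : H →L[ℂ] H} (hS : 0 ≤ S) (x : H) :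
    ‖CFC.sqrt S x‖ ^ 2 = RCLike.re ⟪S x, x⟫_ℂ := by
  have hsa : IsSelfAdjoint (CFC.sqrt S) := (CFC.sqrt_nonneg _).isSelfAdjoint
  conv_rhs => rw [← CFC.sqrt_mul_sqrt_self S hS, ← hsa.star_eq,
    ContinuousLinearMap.star_eq_adjoint, hsa.adjoint_eq]
  change _ = RCLike.re ⟪CFC.sqrt S (CFC.sqrt S x), x⟫_ℂ
  conv_rhs => rw [← hsa.adjoint_eq, ContinuousLinearMap.adjoint_inner_left, hsa.adjoint_eq,
    inner_self_eq_norm_sq]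

/-- The equality lets Douglas' factorisation run both ways, giving contractions that take `|X|` to
`X` and `X` to `|X|`: the two halves of polar decomposition. -/
theorem norm_abs_apply (X : H →L[ℂ] H) (x : H) : ‖CFC.abs X x‖ = ‖X x‖ := by
  have h := norm_sqrt_apply_sq (star_mul_self_nonneg X) x
  have h2 : RCLike.re ⟪(star X * X) x, x⟫_ℂ = ‖X x‖ ^ 2 := by
    rw [ContinuousLinearMap.star_eq_adjoint]
    change RCLike.re ⟪ContinuousLinearMap.adjoint X (X x), x⟫_ℂ = _
    rw [ContinuousLinearMap.adjoint_inner_left, inner_self_eq_norm_sq]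
  rw [h2] at h
  exact (pow_left_inj₀ (norm_nonneg _) (norm_nonneg _) two_ne_zero).1 h

theorem sum_enorm_sq_eq_ofReal (T : Fin N → H →L[ℂ] H) (x : H) :
    ∑ n, ‖T n x‖ₑ ^ 2 = ENNReal.ofReal (∑ n, ‖T n x‖ ^ 2) := by
  rw [ENNReal.ofReal_sum_of_nonneg fun _ _ => by positivity]
  simp_rw [ENNReal.ofReal_pow (norm_nonneg _), ofReal_norm]

theorem columnLE_sqrt_dirSum (T : Fin N → H →L[ℂ] H) : ColumnLE T (CFC.sqrt (dirSum T)) := by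
  intro x
  rw [sum_enorm_sq_eq_ofReal, ← inner_dirSum, ← norm_sqrt_apply_sq (dirSum_nonneg T),
    ENNReal.ofReal_pow (norm_nonneg _), ofReal_norm]

theorem columnLE_dirRoot {t : ℝ} (ht : 0 < t) (T : Fin N → H →L[ℂ] H) :
    ColumnLE T (dirRoot t T) := by
  intro x
  have h0 : 0 ≤ t • (1 : H →L[ℂ] H) + dirSum T :=
    add_nonneg (smul_nonneg ht.le zero_le_one) (dirSum_nonneg T)
  rw [sum_enorm_sq_eq_ofReal, ← ofReal_norm, ← ENNReal.ofReal_pow (norm_nonneg _), dirRoot,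
    norm_sqrt_apply_sq h0, ← inner_dirSum]
  refine ENNReal.ofReal_le_ofReal ?_
  rw [add_apply, inner_add_left, map_add]
  have : 0 ≤ RCLike.re ⟪(t • (1 : H →L[ℂ] H)) x, x⟫_ℂ := by
    change 0 ≤ RCLike.re ⟪t • x, x⟫_ℂ
    rw [← Complex.coe_smul, inner_smul_left, Complex.conj_ofReal, RCLike.re_to_complex,
      Complex.re_ofReal_mul, ← RCLike.re_to_complex]
    exact mul_nonneg ht.le inner_self_nonneg
  linarith

theorem columnBound_sqrt_enorm_dirSum (T : Fin N → H →L[ℂ] H) :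
    ColumnBound T (‖dirSum T‖ₑ ^ (1 / 2 : ℝ)) := by
  intro x
  rw [rpow_half_sq, sum_enorm_sq_eq_ofReal, ← inner_dirSum, ← ofReal_norm, ← ofReal_norm,
    ← ENNReal.ofReal_pow (norm_nonneg _), ← ENNReal.ofReal_mul (norm_nonneg _)]
  refine ENNReal.ofReal_le_ofReal ((re_inner_le_norm _ _).trans ?_)
  have := (dirSum T).le_opNorm x
  nlinarith [norm_nonneg x]

theorem ColumnLE.mul_inverse {T : Fin N → H →L[ℂ] H} {R : H →L[ℂ] H} (h : ColumnLE T R)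
    (hR : IsUnit R) : ColumnBound (fun n => T n * Ring.inverse R) 1 := by
  intro x
  refine (h (Ring.inverse R x)).trans_eq ?_
  rw [one_pow, one_mul]
  congr 2
  exact DFunLike.congr_fun (Ring.mul_inverse_cancel R hR) x

/-- A column dominated by `R` is a column contraction times `R`. -/
theorem ColumnLE.exists_eq_mul {T : Fin N → H →L[ℂ] H} {R : H →L[ℂ] H} (h : ColumnLE T R) :
    ∃ U : Fin N → H →L[ℂ] H, ColumnBound U 1 ∧ ∀ n, T n = U n * R := by
  -- The column is one operator into the Hilbert sum of `N` copies of `H`; the coordinates of its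
  -- Douglas factor are the `U n`.
  let T' : H →L[ℂ] PiLp 2 (fun _ : Fin N => H) :=
    (PiLp.continuousLinearEquiv 2 ℂ (fun _ : Fin N => H)).symm.toContinuousLinearMap.comp
      (ContinuousLinearMap.pi T)
  have key : ∀ v : PiLp 2 (fun _ : Fin N => H), ‖v‖ₑ ^ 2 = ∑ n, ‖v n‖ₑ ^ 2 := fun v => by
    rw [← ofReal_norm, ← ENNReal.ofReal_pow (norm_nonneg _), PiLp.norm_sq_eq_of_L2,
      ENNReal.ofReal_sum_of_nonneg fun _ _ => by positivity]
    simp_rw [ENNReal.ofReal_pow (norm_nonneg _), ofReal_norm]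
  obtain ⟨W, hW, hWT⟩ := exists_contraction_comp_eq T' R fun x => by
    rw [← enorm_le_iff_norm_le]
    exact le_of_sq_le_sq ((key _).trans_le (h x))
  refine ⟨fun n => (PiLp.proj 2 (fun _ : Fin N => H) n : _ →L[ℂ] H).comp W, fun x => ?_,
    fun n => ?_⟩
  · rw [one_pow, one_mul]
    refine (key (W x)).symm.trans_le ?_
    gcongr
    exact enorm_le_iff_norm_le.2 (hW x)
  · ext x
    exact (congrArg (fun v : PiLp 2 (fun _ : Fin N => H) => v n) (hWT x)).symm

/-- A row whose adjoint column has norm at most `k` has itself norm at most `k`. -/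
theorem ColumnBound.row {R : Fin N → H →L[ℂ] H} {k : ℝ≥0∞}
    (h : ColumnBound (fun n => star (R n)) k) (v : Fin N → H) :
    ‖∑ n, R n (v n)‖ₑ ^ 2 ≤ k ^ 2 * ∑ n, ‖v n‖ₑ ^ 2 := by
  set y := ∑ n, R n (v n) with hy
  -- Expand one `y` in `⟪y, y⟫` and move each `R n` across to the other.
  have h1 : ‖y‖ₑ ^ 2 ≤ ∑ n, ‖star (R n) y‖ₑ * ‖v n‖ₑ := by
    have h2 : ‖y‖ ^ 2 ≤ ∑ n, ‖star (R n) y‖ * ‖v n‖ := by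
      rw [← inner_self_eq_norm_sq (𝕜 := ℂ)]
      conv_lhs => rw [hy, inner_sum, ← hy, map_sum]
      refine Finset.sum_le_sum fun n _ => ?_
      rw [ContinuousLinearMap.star_eq_adjoint, ← ContinuousLinearMap.adjoint_inner_left]
      exact re_inner_le_norm _ _
    calc ‖y‖ₑ ^ 2 = ENNReal.ofReal (‖y‖ ^ 2) := by
          rw [ENNReal.ofReal_pow (norm_nonneg _), ofReal_norm]
      _ ≤ _ := ENNReal.ofReal_le_ofReal h2
      _ = _ := by
          rw [ENNReal.ofReal_sum_of_nonneg fun _ _ => by positivity]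
          simp_rw [ENNReal.ofReal_mul (norm_nonneg _), ofReal_norm]
  rcases eq_or_ne y 0 with h0 | h0
  · simp [h0]
  have h3 : ‖y‖ₑ ^ 2 ≠ 0 := by simpa using h0
  have h4 : ‖y‖ₑ ^ 2 ≠ ∞ := by finiteness
  have h5 : ‖y‖ₑ ^ 2 * ‖y‖ₑ ^ 2 ≤ ‖y‖ₑ ^ 2 * (k ^ 2 * ∑ n, ‖v n‖ₑ ^ 2) :=
    calc ‖y‖ₑ ^ 2 * ‖y‖ₑ ^ 2 = (‖y‖ₑ ^ 2) ^ 2 := by ring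
      _ ≤ (∑ n, ‖star (R n) y‖ₑ * ‖v n‖ₑ) ^ 2 := by gcongr
      _ ≤ (∑ n, ‖star (R n) y‖ₑ ^ 2) * ∑ n, ‖v n‖ₑ ^ 2 := sum_mul_sq_le _ _ _
      _ ≤ (k ^ 2 * ‖y‖ₑ ^ 2) * ∑ n, ‖v n‖ₑ ^ 2 := by gcongr; exact h y
      _ = _ := by ring
  exact (ENNReal.mul_le_mul_iff_right h3 h4).1 h5

end Columns

/-! ### Estimates in the operator norm. -/

section OperatorNorm

variable {H : Type*} [NormedAddCommGroup H] [InnerProductSpace ℂ H] [CompleteSpace H] {N : ℕ}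

theorem enorm_apply_le (T : H →L[ℂ] H) (x : H) : ‖T x‖ₑ ≤ ‖T‖ₑ * ‖x‖ₑ := by
  rw [← ofReal_norm, ← ofReal_norm, ← ofReal_norm, ← ENNReal.ofReal_mul (norm_nonneg _)]
  exact ENNReal.ofReal_le_ofReal (T.le_opNorm x)

theorem enorm_le_of_forall_enorm_apply_le {T : H →L[ℂ] H} {c : ℝ≥0∞}
    (h : ∀ x, ‖T x‖ₑ ≤ c * ‖x‖ₑ) : ‖T‖ₑ ≤ c := by
  rcases eq_or_ne c ∞ with rfl | hc
  · exact le_top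
  rw [← ofReal_norm, ← ENNReal.ofReal_toReal hc]
  refine ENNReal.ofReal_le_ofReal (T.opNorm_le_bound ENNReal.toReal_nonneg fun x => ?_)
  have := h x
  rw [← ENNReal.ofReal_toReal hc, ← ofReal_norm, ← ofReal_norm,
    ← ENNReal.ofReal_mul ENNReal.toReal_nonneg] at this
  exact (ENNReal.ofReal_le_ofReal_iff (by positivity)).1 this

theorem enorm_star_eq (T : H →L[ℂ] H) : ‖star T‖ₑ = ‖T‖ₑ := by
  rw [← ofReal_norm, norm_star, ofReal_norm]

theorem enorm_mul_le_mul (S T : H →L[ℂ] H) : ‖S * T‖ₑ ≤ ‖S‖ₑ * ‖T‖ₑ := by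
  rw [← ofReal_norm, ← ofReal_norm, ← ofReal_norm, ← ENNReal.ofReal_mul (norm_nonneg _)]
  exact ENNReal.ofReal_le_ofReal (norm_mul_le _ _)

/-- A row times a diagonal times a column, in the operator norm. -/
theorem enorm_sum_row_mul_column_le {R B : Fin N → H →L[ℂ] H} {k b m : ℝ≥0∞}
    (hR : ColumnBound (fun n => star (R n)) k) (hB : ColumnBound B b)
    (Z : Fin N → H →L[ℂ] H) (hZ : ∀ n, ‖Z n‖ₑ ≤ m) :
    ‖∑ n, R n * Z n * B n‖ₑ ≤ m * k * b := by
  refine enorm_le_of_forall_enorm_apply_le fun x => le_of_sq_le_sq ?_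
  rw [sum_apply]
  calc ‖∑ n, (R n * Z n * B n) x‖ₑ ^ 2 ≤ k ^ 2 * ∑ n, ‖Z n (B n x)‖ₑ ^ 2 :=
        hR.row fun n => Z n (B n x)
    _ ≤ k ^ 2 * ∑ n, (m * ‖B n x‖ₑ) ^ 2 := by
        gcongr with n
        exact (enorm_apply_le _ _).trans (by gcongr; exact hZ n)
    _ = k ^ 2 * m ^ 2 * ∑ n, ‖B n x‖ₑ ^ 2 := by
        simp_rw [mul_pow]
        rw [← Finset.mul_sum, mul_assoc]
    _ ≤ k ^ 2 * m ^ 2 * (b ^ 2 * ‖x‖ₑ ^ 2) := by gcongr; exact hB x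
    _ = _ := by ring

end OperatorNorm

/-! ### Estimates in the Hilbert-Schmidt norm. -/

section HilbertSchmidt

variable {H : Type*} [NormedAddCommGroup H] [InnerProductSpace ℂ H] [CompleteSpace H] {N : ℕ}

theorem hsNorm_sq (X : H →L[ℂ] H) : hsNorm X ^ 2 = ∑' i, ‖X (basis H i)‖ₑ ^ 2 :=
  rpow_half_sq _

theorem hsNorm_star (X : H →L[ℂ] H) : hsNorm (star X) = hsNorm X := by
  rw [hsNorm, ContinuousLinearMap.star_eq_adjoint, ← tsum_enorm_sq_eq_adjoint (basis H), hsNorm]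

/-- The pointwise domination is applied at each `Y eᵢ` and summed over the basis. -/
theorem ColumnLE.sum_hsNorm_sq_le {T : Fin N → H →L[ℂ] H} {R : H →L[ℂ] H} (h : ColumnLE T R)
    (Y : H →L[ℂ] H) : ∑ n, hsNorm (T n * Y) ^ 2 ≤ hsNorm (R * Y) ^ 2 := by
  simp_rw [hsNorm_sq]
  rw [← Summable.tsum_finsetSum fun _ _ => ENNReal.summable]
  exact ENNReal.tsum_le_tsum fun i => h _

theorem ColumnBound.sum_hsNorm_sq_le {T : Fin N → H →L[ℂ] H} {k : ℝ≥0∞} (h : ColumnBound T k)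
    (Y : H →L[ℂ] H) : ∑ n, hsNorm (T n * Y) ^ 2 ≤ k ^ 2 * hsNorm Y ^ 2 := by
  simp_rw [hsNorm_sq]
  rw [← Summable.tsum_finsetSum fun _ _ => ENNReal.summable, ← ENNReal.tsum_mul_left]
  exact ENNReal.tsum_le_tsum fun i => h _

theorem ColumnBound.sum_hsNorm_mul_sq_le {R : Fin N → H →L[ℂ] H} {k : ℝ≥0∞}
    (h : ColumnBound (fun n => star (R n)) k) (Y : H →L[ℂ] H) :
    ∑ n, hsNorm (Y * R n) ^ 2 ≤ k ^ 2 * hsNorm Y ^ 2 := by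
  simpa only [← star_mul, hsNorm_star] using h.sum_hsNorm_sq_le (star Y)

theorem ColumnBound.hsNorm_sum_sq_le {R : Fin N → H →L[ℂ] H} {k : ℝ≥0∞}
    (h : ColumnBound (fun n => star (R n)) k) (Y : Fin N → H →L[ℂ] H) :
    hsNorm (∑ n, R n * Y n) ^ 2 ≤ k ^ 2 * ∑ n, hsNorm (Y n) ^ 2 := by
  simp_rw [hsNorm_sq]
  rw [← Summable.tsum_finsetSum fun _ _ => ENNReal.summable, ← ENNReal.tsum_mul_left]
  refine ENNReal.tsum_le_tsum fun i => ?_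
  rw [sum_apply]
  exact h.row fun n => Y n (basis H i)

theorem hsNorm_mul_le (T Y : H →L[ℂ] H) : hsNorm (T * Y) ≤ ‖T‖ₑ * hsNorm Y := by
  refine le_of_sq_le_sq ?_
  rw [mul_pow, hsNorm_sq, hsNorm_sq, ← ENNReal.tsum_mul_left]
  refine ENNReal.tsum_le_tsum fun i => ?_
  rw [← mul_pow]
  gcongr
  exact enorm_apply_le _ _

theorem hsNorm_mul_le_right (Y T : H →L[ℂ] H) : hsNorm (Y * T) ≤ hsNorm Y * ‖T‖ₑ := by
  rw [← hsNorm_star, star_mul, ← hsNorm_star Y, ← enorm_star_eq T, mul_comm]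
  exact hsNorm_mul_le _ _

/-- A row times a diagonal, in the Hilbert-Schmidt norm. -/
theorem hsNorm_sum_row_le {R C B Z : Fin N → H →L[ℂ] H} {k z : ℝ≥0∞}
    (hR : ColumnBound (fun n => star (R n)) k) (hZ : ∑ n, hsNorm (Z n) ^ 2 ≤ z ^ 2) :
    hsNorm (∑ n, R n * (C n * Z n * B n)) ≤ (⨆ n, ‖B n‖ₑ) * (⨆ n, ‖C n‖ₑ) * k * z := by
  refine le_of_sq_le_sq ?_
  calc _ ≤ k ^ 2 * ∑ n, hsNorm (C n * Z n * B n) ^ 2 := hR.hsNorm_sum_sq_le _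
    _ ≤ k ^ 2 * ∑ n, ((⨆ n, ‖C n‖ₑ) * hsNorm (Z n) * (⨆ n, ‖B n‖ₑ)) ^ 2 := by
        gcongr with n
        refine (hsNorm_mul_le_right _ _).trans ?_
        gcongr
        · exact (hsNorm_mul_le _ _).trans (by gcongr; exact le_iSup (fun n => ‖C n‖ₑ) n)
        · exact le_iSup (fun n => ‖B n‖ₑ) n
    _ = k ^ 2 * ((⨆ n, ‖C n‖ₑ) ^ 2 * (∑ n, hsNorm (Z n) ^ 2) * (⨆ n, ‖B n‖ₑ) ^ 2) := by
        simp_rw [mul_pow]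
        rw [← Finset.sum_mul, ← Finset.mul_sum]
    _ ≤ k ^ 2 * ((⨆ n, ‖C n‖ₑ) ^ 2 * z ^ 2 * (⨆ n, ‖B n‖ₑ) ^ 2) := by gcongr
    _ = _ := by ring

/-- A diagonal times a column, in the Hilbert-Schmidt norm. -/
theorem hsNorm_sum_column_le {A Z D B : Fin N → H →L[ℂ] H} {k z : ℝ≥0∞}
    (hB : ColumnBound B k) (hZ : ∑ n, hsNorm (Z n) ^ 2 ≤ z ^ 2) :
    hsNorm (∑ n, A n * Z n * D n * B n) ≤ (⨆ n, ‖A n‖ₑ) * (⨆ n, ‖D n‖ₑ) * k * z := by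
  -- Adjoints turn the column into a row and reverse every product, so `D` and `A` take the places
  -- of `C` and `B`.
  have h := hsNorm_sum_row_le (R := fun n => star (B n)) (C := fun n => star (D n))
    (B := fun n => star (A n)) (Z := fun n => star (Z n)) (k := k) (z := z)
    (by simpa using hB) (by simpa [hsNorm_star] using hZ)
  simp only [enorm_star_eq] at h
  rw [← hsNorm_star, star_sum]
  simpa [mul_assoc] using h

end HilbertSchmidt

/-! ### Estimates in the trace norm. -/

section TraceNorm

variable {H : Type*} [NormedAddCommGroup H] [InnerProductSpace ℂ H] [CompleteSpace H] {N : ℕ}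

/-- A trace class operator is a product of two Hilbert-Schmidt operators. -/
theorem exists_mul_eq_hsNorm_sq_le_traceNorm (X : H →L[ℂ] H) :
    ∃ Y Z : H →L[ℂ] H, X = Y * Z ∧ hsNorm Y ^ 2 ≤ traceNorm X ∧ hsNorm Z ^ 2 ≤ traceNorm X := by
  obtain ⟨W, hW, hWX⟩ := exists_contraction_comp_eq X (CFC.abs X) fun x => (norm_abs_apply X x).ge
  have hS : hsNorm (CFC.sqrt (CFC.abs X)) ^ 2 = traceNorm X := by
    rw [hsNorm_sq, traceNorm]
    refine tsum_congr fun i => ?_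
    rw [← norm_sqrt_apply_sq (CFC.abs_nonneg X), ENNReal.ofReal_pow (norm_nonneg _), ofReal_norm]
  -- With `X = W |X|`, the factors are `W |X|^(1/2)` and `|X|^(1/2)`; the second has squared
  -- Hilbert-Schmidt norm exactly `tr |X|`.
  refine ⟨W * CFC.sqrt (CFC.abs X), CFC.sqrt (CFC.abs X), ?_, ?_, hS.le⟩
  · rw [mul_assoc, CFC.sqrt_mul_sqrt_self _ (CFC.abs_nonneg X)]
    ext x
    exact (hWX x).symm
  · rw [← hS, hsNorm_sq, hsNorm_sq]
    refine ENNReal.tsum_le_tsum fun i => ?_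
    gcongr
    exact enorm_le_iff_norm_le.2 (hW _)

/-- Cauchy-Schwarz for the trace norm of a sum of products. -/
theorem traceNorm_sum_mul_le (Y Z : Fin N → H →L[ℂ] H) :
    traceNorm (∑ n, Y n * Z n) ≤ ∑ n, hsNorm (Y n) * hsNorm (Z n) := by
  set T := ∑ n, Y n * Z n with hT
  -- Since `|T| = V T`, the diagonal terms of `|T|` become sums of `⟪Zₙ x, (V Yₙ)* x⟫`.
  obtain ⟨V, hV, hVT⟩ := exists_contraction_comp_eq (CFC.abs T) T fun x => (norm_abs_apply T x).le
  have hV1 : ‖V‖ₑ ≤ 1 := enorm_le_of_forall_enorm_apply_le fun x => by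
    rw [one_mul]
    exact enorm_le_iff_norm_le.2 (hV x)
  have key : ∀ x, ENNReal.ofReal (RCLike.re ⟪CFC.abs T x, x⟫_ℂ)
      ≤ ∑ n, ‖star (V * Y n) x‖ₑ * ‖Z n x‖ₑ := by
    intro x
    have h1 : RCLike.re ⟪CFC.abs T x, x⟫_ℂ ≤ ∑ n, ‖star (V * Y n) x‖ * ‖Z n x‖ := by
      rw [← hVT, hT, sum_apply, map_sum, sum_inner, map_sum]
      refine Finset.sum_le_sum fun n _ => ?_
      change RCLike.re ⟪(V * Y n) (Z n x), x⟫_ℂ ≤ _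
      rw [ContinuousLinearMap.star_eq_adjoint, ← ContinuousLinearMap.adjoint_inner_right, mul_comm]
      exact re_inner_le_norm _ _
    refine (ENNReal.ofReal_le_ofReal h1).trans_eq ?_
    rw [ENNReal.ofReal_sum_of_nonneg fun _ _ => by positivity]
    simp_rw [ENNReal.ofReal_mul (norm_nonneg _), ofReal_norm]
  calc traceNorm T ≤ ∑' i, ∑ n, ‖star (V * Y n) (basis H i)‖ₑ * ‖Z n (basis H i)‖ₑ :=
        ENNReal.tsum_le_tsum fun i => key _
    _ = ∑ n, ∑' i, ‖star (V * Y n) (basis H i)‖ₑ * ‖Z n (basis H i)‖ₑ :=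
        Summable.tsum_finsetSum fun _ _ => ENNReal.summable
    _ ≤ ∑ n, hsNorm (star (V * Y n)) * hsNorm (Z n) :=
        Finset.sum_le_sum fun n _ => tsum_mul_le_sqrt_mul_sqrt _ _
    _ ≤ ∑ n, hsNorm (Y n) * hsNorm (Z n) := by
        gcongr with n
        rw [hsNorm_star]
        exact (hsNorm_mul_le _ _).trans (mul_le_of_le_one_left' hV1)

/-- A column contraction and a row contraction around `X`, in the trace norm. -/
theorem traceNorm_sum_le {A U V B : Fin N → H →L[ℂ] H} (hU : ColumnBound U 1)
    (hV : ColumnBound (fun n => star (V n)) 1) (X : H →L[ℂ] H) :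
    traceNorm (∑ n, A n * U n * X * V n * B n) ≤ (⨆ n, ‖A n‖ₑ * ‖B n‖ₑ) * traceNorm X := by
  obtain ⟨Y, Z, rfl, hY, hZ⟩ := exists_mul_eq_hsNorm_sq_le_traceNorm X
  set t := traceNorm (Y * Z)
  have hUY : ∑ n, hsNorm (U n * Y) ^ 2 ≤ t := (hU.sum_hsNorm_sq_le Y).trans (by simpa using hY)
  have hZV : ∑ n, hsNorm (Z * V n) ^ 2 ≤ t :=
    (hV.sum_hsNorm_mul_sq_le Z).trans (by simpa using hZ)
  calc traceNorm (∑ n, A n * U n * (Y * Z) * V n * B n)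
      = traceNorm (∑ n, (A n * (U n * Y)) * ((Z * V n) * B n)) := by simp only [mul_assoc]
    _ ≤ ∑ n, hsNorm (A n * (U n * Y)) * hsNorm ((Z * V n) * B n) := traceNorm_sum_mul_le _ _
    _ ≤ ∑ n, (‖A n‖ₑ * hsNorm (U n * Y)) * (hsNorm (Z * V n) * ‖B n‖ₑ) := by
        gcongr
        · exact hsNorm_mul_le _ _
        · exact hsNorm_mul_le_right _ _
    _ = ∑ n, (‖A n‖ₑ * ‖B n‖ₑ) * (hsNorm (U n * Y) * hsNorm (Z * V n)) :=
        Finset.sum_congr rfl fun n _ => by ring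
    _ ≤ ∑ n, (⨆ n, ‖A n‖ₑ * ‖B n‖ₑ) * (hsNorm (U n * Y) * hsNorm (Z * V n)) := by
        gcongr with n
        exact le_iSup (fun n => ‖A n‖ₑ * ‖B n‖ₑ) n
    _ = (⨆ n, ‖A n‖ₑ * ‖B n‖ₑ) * ∑ n, hsNorm (U n * Y) * hsNorm (Z * V n) := by
        rw [Finset.mul_sum]
    _ ≤ (⨆ n, ‖A n‖ₑ * ‖B n‖ₑ) * (t ^ (1 / 2 : ℝ) * t ^ (1 / 2 : ℝ)) := by
        gcongr
        refine (sum_mul_le_sqrt_mul_sqrt _ _ _).trans ?_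
        gcongr
    _ = _ := by rw [← sq, rpow_half_sq]

end TraceNorm

/-! ### Weighted rows as adjoint columns. -/

section Weights

variable {H : Type*} [NormedAddCommGroup H] [InnerProductSpace ℂ H] [CompleteSpace H] {N : ℕ}
variable {l : Fin N → ℝ}

/-- Absorbing `√(l n)` into `T n` and taking adjoints reduces every weighted row statement to the
column case. -/
theorem starSum_eq_dirSum (hl : ∀ n, 0 ≤ l n) (T : Fin N → H →L[ℂ] H) :
    starSum l T = dirSum fun n => star (√(l n) • T n) := by
  simp only [starSum, dirSum, star_star]
  refine Finset.sum_congr rfl fun n _ => ?_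
  rw [star_smul, smul_mul_smul_comm, star_trivial (√(l n)), Real.mul_self_sqrt (hl n)]

theorem isSelfAdjoint_starRoot (t : ℝ) (T : Fin N → H →L[ℂ] H) :
    IsSelfAdjoint (starRoot t l T) :=
  (CFC.sqrt_nonneg _).isSelfAdjoint

theorem columnLE_starRoot (hl : ∀ n, 0 ≤ l n) {t : ℝ} (ht : 0 < t) (T : Fin N → H →L[ℂ] H) :
    ColumnLE (fun n => star (√(l n) • T n)) (starRoot t l T) := by
  rw [starRoot, starSum_eq_dirSum hl]
  exact columnLE_dirRoot ht _

theorem columnLE_sqrt_starSum (hl : ∀ n, 0 ≤ l n) (T : Fin N → H →L[ℂ] H) :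
    ColumnLE (fun n => star (√(l n) • T n)) (CFC.sqrt (starSum l T)) := by
  rw [starSum_eq_dirSum hl]
  exact columnLE_sqrt_dirSum _

theorem columnBound_starSum (hl : ∀ n, 0 ≤ l n) (T : Fin N → H →L[ℂ] H) :
    ColumnBound (fun n => star (√(l n) • T n)) (‖starSum l T‖ₑ ^ (1 / 2 : ℝ)) := by
  rw [starSum_eq_dirSum hl]
  exact columnBound_sqrt_enorm_dirSum _

theorem columnBound_mul_inverse_dirRoot {t : ℝ} (ht : 0 < t) (T : Fin N → H →L[ℂ] H) :
    ColumnBound (fun n => T n * Ring.inverse (dirRoot t T)) 1 :=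
  (columnLE_dirRoot ht T).mul_inverse (isUnit_dirRoot ht T)

theorem columnBound_inverse_starRoot_mul (hl : ∀ n, 0 ≤ l n) {t : ℝ} (ht : 0 < t)
    (T : Fin N → H →L[ℂ] H) :
    ColumnBound (fun n => star (Ring.inverse (starRoot t l T) * (√(l n) • T n))) 1 := by
  simpa only [star_mul, ← Ring.inverse_star, (isSelfAdjoint_starRoot t T).star_eq] using
    (columnLE_starRoot hl ht T).mul_inverse (isUnit_starRoot ht hl T)

theorem enorm_mul_mul_le_iSup (C D : Fin N → H →L[ℂ] H) (X : H →L[ℂ] H) (n : Fin N) :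
    ‖C n * X * D n‖ₑ ≤ (⨆ n, ‖C n‖ₑ * ‖D n‖ₑ) * ‖X‖ₑ :=
  calc ‖C n * X * D n‖ₑ ≤ ‖C n‖ₑ * ‖X‖ₑ * ‖D n‖ₑ :=
        (enorm_mul_le_mul _ _).trans (by gcongr; exact enorm_mul_le_mul _ _)
    _ = (‖C n‖ₑ * ‖D n‖ₑ) * ‖X‖ₑ := by ring
    _ ≤ _ := by gcongr; exact le_iSup (fun n => ‖C n‖ₑ * ‖D n‖ₑ) n

/-- Only `≤` is available: the supremum is `0` when `N = 0` or `H` is trivial. -/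
theorem iSup_enorm_one_le : (⨆ _ : Fin N, ‖(1 : H →L[ℂ] H)‖ₑ) ≤ 1 :=
  iSup_le fun _ => enorm_le_of_forall_enorm_apply_le fun x => by simp

theorem iSup_enorm_one_mul_enorm_one_le :
    (⨆ _ : Fin N, ‖(1 : H →L[ℂ] H)‖ₑ * ‖(1 : H →L[ℂ] H)‖ₑ) ≤ 1 :=
  iSup_le fun n => mul_le_one' ((le_iSup (fun _ => _) n).trans iSup_enorm_one_le)
    ((le_iSup (fun _ => _) n).trans iSup_enorm_one_le)

end Weights

/-! ### The bounds and the contractive estimates. -/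

section Bounds

variable {H : Type*} [NormedAddCommGroup H] [InnerProductSpace ℂ H] [CompleteSpace H] {N : ℕ}
variable {l w : Fin N → ℝ}

theorem unnormalisedOp (hl : ∀ n, 0 ≤ l n) : UnnormalisedOp H l := by
  intro A B C D X
  have h := enorm_sum_row_mul_column_le (columnBound_starSum hl A)
    (columnBound_sqrt_enorm_dirSum B) _ (enorm_mul_mul_le_iSup C D X)
  simp only [smul_mul_assoc, ← mul_assoc] at h
  exact h.trans_eq (by ring)

theorem normalisedOp (hl : ∀ n, 0 ≤ l n) : NormalisedOp H l := by
  intro A B C D η ζ hη hζ X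
  have h := enorm_sum_row_mul_column_le (columnBound_inverse_starRoot_mul hl hη A)
    (columnBound_mul_inverse_dirRoot hζ B) _ (enorm_mul_mul_le_iSup C D X)
  simpa only [Finset.mul_sum, Finset.sum_mul, mul_smul_comm, smul_mul_assoc, ← mul_assoc, mul_one]
    using h

theorem unnormalisedHSRight : UnnormalisedHSRight H N := by
  intro A B C D X _
  have h := hsNorm_sum_column_le (A := A) (D := D) (columnBound_sqrt_enorm_dirSum B)
    ((columnLE_sqrt_dirSum C).sum_hsNorm_sq_le X)
  simpa only [← mul_assoc] using h

theorem normalisedHSRight : NormalisedHSRight H N := by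
  intro A B C D η ζ hη hζ X _
  have h := hsNorm_sum_column_le (A := A) (D := D) (z := hsNorm X)
    (columnBound_mul_inverse_dirRoot hζ B)
    (((columnBound_mul_inverse_dirRoot hη C).sum_hsNorm_sq_le X).trans (by simp))
  simpa only [← mul_assoc, mul_one] using h

theorem unnormalisedHSLeft (hl : ∀ n, 0 ≤ l n) (hw : ∀ n, 0 ≤ w n) :
    UnnormalisedHSLeft H l w := by
  intro A B C D X _
  -- This is the adjoint of the column estimate for `star X`; the square root is self-adjoint.
  have hZ : ∑ n, hsNorm (X * (√(w n) • D n)) ^ 2 ≤ hsNorm (X * CFC.sqrt (starSum w D)) ^ 2 := by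
    have hs : star (CFC.sqrt (starSum w D)) = CFC.sqrt (starSum w D) :=
      (CFC.sqrt_nonneg _).isSelfAdjoint.star_eq
    have h := (columnLE_sqrt_starSum hw D).sum_hsNorm_sq_le (star X)
    rw [← hs] at h
    simpa only [← star_mul, hsNorm_star] using h
  have h := hsNorm_sum_row_le (C := C) (B := B) (columnBound_starSum hl A) hZ
  simp_rw [fun n => mul_comm (√(l n)) (√(w n))]
  simpa only [smul_mul_assoc, mul_smul_comm, smul_smul, ← mul_assoc] using h

theorem normalisedHSLeft (hl : ∀ n, 0 ≤ l n) (hw : ∀ n, 0 ≤ w n) : NormalisedHSLeft H l w := by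
  intro A B C D η θ hη hθ X _
  have h := hsNorm_sum_row_le (C := C) (B := B) (z := hsNorm X)
    (columnBound_inverse_starRoot_mul hl hη A)
    (((columnBound_inverse_starRoot_mul hw hθ D).sum_hsNorm_mul_sq_le X).trans (by simp))
  simp_rw [fun n => mul_comm (√(l n)) (√(w n))]
  simpa only [Finset.mul_sum, smul_mul_assoc, mul_smul_comm, smul_smul, ← mul_assoc, mul_one]
    using h

theorem unnormalisedTrace (hw : ∀ n, 0 ≤ w n) : UnnormalisedTrace H w := by
  intro A B C D X _
  obtain ⟨U, hU, hUC⟩ := (columnLE_sqrt_dirSum C).exists_eq_mul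
  obtain ⟨V, hV, hVD⟩ := (columnLE_sqrt_starSum hw D).exists_eq_mul
  -- The adjoint of the Douglas factorisation places the square root next to `X` and leaves a row
  -- contraction on its right.
  have hD : ∀ n, √(w n) • D n = CFC.sqrt (starSum w D) * star (V n) := fun n => by
    rw [← star_star (√(w n) • D n), hVD, star_mul, (CFC.sqrt_nonneg _).isSelfAdjoint.star_eq]
  have h := traceNorm_sum_le (A := A) (B := B) (V := fun n => star (V n)) hU (by simpa using hV)
    (CFC.sqrt (dirSum C) * X * CFC.sqrt (starSum w D))
  convert h using 2
  refine Finset.sum_congr rfl fun n _ => ?_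
  calc √(w n) • (A n * C n * X * D n * B n) = A n * C n * X * (√(w n) • D n) * B n := by
        rw [mul_smul_comm, smul_mul_assoc]
    _ = _ := by rw [hD, hUC]; simp only [mul_assoc]

theorem normalisedTrace (hw : ∀ n, 0 ≤ w n) : NormalisedTrace H w := by
  intro A B C D η θ hη hθ X _
  have h := traceNorm_sum_le (A := A) (B := B) (columnBound_mul_inverse_dirRoot hη C)
    (columnBound_inverse_starRoot_mul hw hθ D) X
  simpa only [smul_mul_assoc, mul_smul_comm, ← mul_assoc] using h

theorem NormalisedOp.contractiveOp (h : NormalisedOp H l) : ContractiveOp H l := by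
  intro A B η ζ hη hζ X
  have h1 := h A B (fun _ => 1) (fun _ => 1) η ζ hη hζ X
  simp only [mul_one] at h1
  exact h1.trans (mul_le_of_le_one_left' iSup_enorm_one_mul_enorm_one_le)

theorem NormalisedHSRight.contractiveHSRight (h : NormalisedHSRight H N) :
    ContractiveHSRight H N := by
  intro A B ε ζ hε hζ X hX
  -- The contractive family `A` fills the slot beside `X`, where the normalising inverse belongs to
  -- `C`.
  have h1 := h (fun _ => 1) B A (fun _ => 1) ε ζ hε hζ X hX
  simp only [mul_one, one_mul] at h1
  exact h1.trans (mul_le_of_le_one_left' (mul_le_one' iSup_enorm_one_le iSup_enorm_one_le))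

theorem NormalisedHSLeft.contractiveHSLeft (h : NormalisedHSLeft H l w) :
    ContractiveHSLeft H l w := by
  intro A B η θ hη hθ X hX
  have h1 := h A (fun _ => 1) (fun _ => 1) B η θ hη hθ X hX
  simp only [mul_one] at h1
  exact h1.trans (mul_le_of_le_one_left' (mul_le_one' iSup_enorm_one_le iSup_enorm_one_le))

theorem NormalisedTrace.contractiveTrace (h : NormalisedTrace H w) : ContractiveTrace H w := by
  intro A B ε θ hε hθ X hX
  have h1 := h (fun _ => 1) (fun _ => 1) A B ε θ hε hθ X hX
  simp only [mul_one, one_mul] at h1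
  exact h1.trans (mul_le_of_le_one_left' iSup_enorm_one_mul_enorm_one_le)

theorem NormalisedBounds.contractiveBounds (h : NormalisedBounds H l w) :
    ContractiveBounds H l w :=
  ⟨h.1.contractiveOp, h.2.1.contractiveHSRight, h.2.2.1.contractiveHSLeft,
    h.2.2.2.contractiveTrace⟩

theorem normalisedBounds (hl : ∀ n, 0 ≤ l n) (hw : ∀ n, 0 ≤ w n) : NormalisedBounds H l w :=
  ⟨normalisedOp hl, normalisedHSRight, normalisedHSLeft hl hw, normalisedTrace hw⟩

theorem unnormalisedBounds (hl : ∀ n, 0 ≤ l n) (hw : ∀ n, 0 ≤ w n) : UnnormalisedBounds H l w :=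
  ⟨unnormalisedOp hl, unnormalisedHSRight, unnormalisedHSLeft hl hw, unnormalisedTrace hw⟩

end Bounds

end SchattenCS

end

theorem mainTheorem3 {H : Type*} [NormedAddCommGroup H] [InnerProductSpace ℂ H] [CompleteSpace H]
    [TopologicalSpace.SeparableSpace H] {N : ℕ} (l w : Fin N → ℝ)
    (hl : ∀ n, 0 ≤ l n) (hw : ∀ n, 0 ≤ w n) :
    SchattenCS.NormalisedBounds H l w ∧
    SchattenCS.UnnormalisedBounds H l w ∧
    SchattenCS.ContractiveBounds H l w ∧
    -- each normalised bound is equivalent to its unnormalised form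
    (SchattenCS.NormalisedOp H l ↔ SchattenCS.UnnormalisedOp H l) ∧
    (SchattenCS.NormalisedHSRight H N ↔ SchattenCS.UnnormalisedHSRight H N) ∧
    (SchattenCS.NormalisedHSLeft H l w ↔ SchattenCS.UnnormalisedHSLeft H l w) ∧
    (SchattenCS.NormalisedTrace H w ↔ SchattenCS.UnnormalisedTrace H w) ∧
    -- either quadruple implies the contractive estimates
    (SchattenCS.NormalisedBounds H l w → SchattenCS.ContractiveBounds H l w) ∧
    (SchattenCS.UnnormalisedBounds H l w → SchattenCS.ContractiveBounds H l w) :=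
  ⟨SchattenCS.normalisedBounds hl hw,
    SchattenCS.unnormalisedBounds hl hw,
    (SchattenCS.normalisedBounds hl hw).contractiveBounds,
    iff_of_true (SchattenCS.normalisedOp hl) (SchattenCS.unnormalisedOp hl),
    iff_of_true SchattenCS.normalisedHSRight SchattenCS.unnormalisedHSRight,
    iff_of_true (SchattenCS.normalisedHSLeft hl hw) (SchattenCS.unnormalisedHSLeft hl hw),
    iff_of_true (SchattenCS.normalisedTrace hw) (SchattenCS.unnormalisedTrace hw),
    SchattenCS.NormalisedBounds.contractiveBounds,
    fun _ => (SchattenCS.normalisedBounds hl hw).contractiveBounds⟩
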